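/- Let $X_1, X_2, \ldots$ be independent real random variables with a common continuous distribution (that is, a continuous distribution function), and let $\mathcal F_i = \sigma\{X_1,\ldots,X_i\}$. For $n \ge 1$ let $\Pi(n)$ be the set of all selection policies, that is, of all sequences $\pi=(\tau_1,\ldots,\tau_n)$ of stopping times with respect to $(\mathcal F_i)$ such that, almost surely, $1\le \tau_1<\tau_2<\cdots<\tau_n<\infty$ and $X_{\tau_1}<X_{\tau_2}<\cdots<X_{\tau_n}$, and such that $\mathbb E[\tau_n]<\infty$. Then for every $n \ge 1$ the minimum $$\beta(n)=\min_{\pi\in\Pi(n)}\mathbb E[\tau_n]$$ is attained; the function $n\mapsto\beta(n)$ is convex on $\{1,2,\ldots\}$, that is, $\beta(n+1)-\beta(n)\le\beta(n+2)-\beta(n+1)$ for all $n\ge1$; $\beta(1)=1$; and for all $n\ge 2$ one has $$\tfrac12 n^2\le\beta(n)\le\tfrac12 n^2+n\log n .$$ -/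

import Mathlib

open MeasureTheory ProbabilityTheory

namespace OnlineSelection

variable {Ω : Type*} {m : MeasurableSpace Ω}

/-- The observations are `X 1, X 2, …`; the entry `X 0` of the sequence is never used.
This is the filtration `𝓕 i = σ(X 1, …, X i)`, whose entry at `0` is the trivial σ-algebra. -/
def obsFiltration (X : ℕ → Ω → ℝ) (hX : ∀ i, 1 ≤ i → Measurable (X i)) : Filtration ℕ m where
  seq i := ⨆ j ∈ Set.Icc 1 i, MeasurableSpace.comap (X j) inferInstance
  mono' _ _ hij := biSup_mono fun _ hk => ⟨hk.1, hk.2.trans hij⟩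
  le' _ := iSup₂_le fun j hj => (hX j hj.1).comap_le

/-- `Π(n)`: the selection policies `(τ 1, …, τ n)` with `𝔼[τ n] < ∞`.
Only the entries `τ k` with `1 ≤ k ≤ n` matter. -/
structure IsSelectionPolicy (X : ℕ → Ω → ℝ) (hX : ∀ i, 1 ≤ i → Measurable (X i))
    (μ : Measure Ω) (n : ℕ) (τ : ℕ → Ω → ℕ∞) : Prop where
  /-- Each selection time is a stopping time of the observations. -/
  isStoppingTime : ∀ k ∈ Set.Icc 1 n, IsStoppingTime (obsFiltration X hX) (τ k)
  /-- Almost surely the selection times are finite. -/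
  finite : ∀ᵐ ω ∂μ, ∀ k ∈ Set.Icc 1 n, τ k ω ≠ ⊤
  /-- The first observation arrives at time `1`. -/
  one_le : ∀ᵐ ω ∂μ, ∀ k ∈ Set.Icc 1 n, 1 ≤ τ k ω
  /-- `τ 1 < τ 2 < ⋯ < τ n` almost surely. -/
  time_lt : ∀ᵐ ω ∂μ, ∀ k, 1 ≤ k → k < n → τ k ω < τ (k + 1) ω
  /-- The selected values are increasing almost surely. -/
  value_lt : ∀ᵐ ω ∂μ, ∀ k, 1 ≤ k → k < n →
    X (τ k ω).toNat ω < X (τ (k + 1) ω).toNat ω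
  /-- The expected completion time is finite. -/
  expectation_lt_top : ∫⁻ ω, (τ n ω : ENNReal) ∂μ < ⊤

/-- The set of the values `𝔼[τ n]`, over all policies in `Π(n)`. -/
noncomputable def expectedTimes (X : ℕ → Ω → ℝ) (hX : ∀ i, 1 ≤ i → Measurable (X i))
    (μ : Measure Ω) (n : ℕ) : Set ℝ :=
  {e | ∃ τ : ℕ → Ω → ℕ∞, IsSelectionPolicy X hX μ n τ ∧
    e = (∫⁻ ω, (τ n ω : ENNReal) ∂μ).toReal}

/-- `β(n)`, for `n ≥ 1`: the smallest expected time needed to select an increasing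
subsequence of length `n`. -/
noncomputable def beta (X : ℕ → Ω → ℝ) (hX : ∀ i, 1 ≤ i → Measurable (X i))
    (μ : Measure Ω) (n : ℕ) : ℝ :=
  sInf (expectedTimes X hX μ n)

end OnlineSelection

namespace OnlineSelection

/-! ### The recursion for the optimal values -/

/-! Applying the distribution function turns the observations into independent uniform variables
(`isUniformStream_cdf`). The decision problem then has as state the number `k` of values still
needed and the last selected value `l`. Only observations in `(l, 1]` are useful, and rescaling that
interval shows that the optimal remaining time has the form `v k / (1 - l)`. The Bellman equation at
`l = 0` is `v (k+1) = 1 + ∫₀¹ min (v (k+1)) (v k / (1 - x)) dx`. The two terms of the minimum cross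
at `1 - x = v k / v (k+1)`, so the equation becomes `v (k+1) = 1 + v k + v k * log (v (k+1) / v k)`.
This scalar recursion is `optValue`.

Optimality is a verification argument. For the threshold rule, expected elapsed time plus expected
remaining value does not increase (`sum_add_lintegral_valueFn_le`), which bounds its cost above by
`v n`. For an arbitrary policy, the time up to a finite horizon `N` dominates `horizonValue N`
(`horizonValue_le_sum`). The supremum of these over `N` satisfies the Bellman inequality, and every
solution of that inequality is at least `v k / (1 - l)` (`valueFn_succ_le_of_bellman`). Truncating
at `N` avoids any control of the state at infinity.

Convexity and the two bounds then concern the recursion alone: they follow from concavity of `log`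
and from rational bounds of `log`, applied to the increments of `v`. -/

theorem exists_bellman_root {c : ℝ} (hc : 0 ≤ c) :
    ∃ V, c ≤ V ∧ V = 1 + c + c * Real.log (V / c) := by
  rcases hc.eq_or_lt with rfl | hc
  · exact ⟨1, by norm_num, by simp⟩
  let f : ℝ → ℝ := fun V => V - (1 + c + c * Real.log (V / c))
  have hcont : ContinuousOn f (Set.Icc c (2 * c + 2)) := by
    refine continuousOn_id.sub (continuousOn_const.add (continuousOn_const.mul ?_))
    refine ContinuousOn.log (continuousOn_id.div_const c) fun x hx => ?_
    have : 0 < x := hc.trans_le hx.1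
    exact (div_pos this hc).ne'
  have h0 : f c ≤ 0 := by simp [f, div_self hc.ne']
  -- The endpoint is chosen so that the bound `log r ≤ (r - r⁻¹) / 2`, which is `x ≤ sinh x` at `x =
  -- log r`, cancels the linear terms exactly.
  have h1 : 0 ≤ f (2 * c + 2) := by
    have hr : (1 : ℝ) ≤ (2 * c + 2) / c := by rw [le_div_iff₀ hc]; linarith
    have hlog : Real.log ((2 * c + 2) / c) ≤ ((2 * c + 2) / c - ((2 * c + 2) / c)⁻¹) / 2 := by
      rw [← Real.sinh_log (by positivity)]
      exact Real.self_le_sinh_iff.2 (Real.log_nonneg hr)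
    have h2 := mul_le_mul_of_nonneg_left hlog hc.le
    have h3 : c * (((2 * c + 2) / c - ((2 * c + 2) / c)⁻¹) / 2) = c + 1 - c ^ 2 / (4 * (c + 1)) := by
      field_simp
      ring
    have : 0 ≤ c ^ 2 / (4 * (c + 1)) := by positivity
    simp only [f]
    linarith
  obtain ⟨V, hV, hfV⟩ := intermediate_value_Icc (by linarith) hcont ⟨h0, h1⟩
  exact ⟨V, hV.1, by simp only [f] at hfV; linarith⟩

/-- `optValue k` is the optimal expected time for selecting `k` further values when the last
selected value is the lower end of the range of the observations. -/
noncomputable def optValue : ℕ → {c : ℝ // 0 ≤ c}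
  | 0 => ⟨0, le_rfl⟩
  | k + 1 => ⟨(exists_bellman_root (optValue k).2).choose,
      (optValue k).2.trans (exists_bellman_root (optValue k).2).choose_spec.1⟩

theorem optValue_zero : (optValue 0 : ℝ) = 0 := rfl

theorem optValue_le_succ (k : ℕ) : (optValue k : ℝ) ≤ optValue (k + 1) :=
  (exists_bellman_root (optValue k).2).choose_spec.1

theorem optValue_succ_eq (k : ℕ) : (optValue (k + 1) : ℝ) =
    1 + optValue k + optValue k * Real.log (optValue (k + 1) / optValue k) :=
  (exists_bellman_root (optValue k).2).choose_spec.2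

theorem optValue_nonneg (k : ℕ) : 0 ≤ (optValue k : ℝ) := (optValue k).2

theorem optValue_one : (optValue 1 : ℝ) = 1 := by
  have := optValue_succ_eq 0
  simpa [optValue_zero] using this

theorem one_le_optValue_succ (k : ℕ) : 1 ≤ (optValue (k + 1) : ℝ) := by
  induction k with
  | zero => exact optValue_one.ge
  | succ k ih => exact ih.trans (optValue_le_succ _)

theorem optValue_add_one_le_succ (k : ℕ) : (optValue k : ℝ) + 1 ≤ optValue (k + 1) := by
  have h := optValue_succ_eq k
  have : 0 ≤ (optValue k : ℝ) * Real.log (optValue (k + 1) / optValue k) := by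
    rcases (optValue_nonneg k).eq_or_lt with h0 | h0
    · simp [← h0]
    · exact mul_nonneg h0.le (Real.log_nonneg ((one_le_div h0).2 (optValue_le_succ k)))
  linarith

/-- Strict monotonicity of `A ↦ A - c * log (A / c)` on `[c, ∞)`, from `log r < r - 1` at `r = B /
A`. It makes every supersolution of the scalar equation an upper bound for the root. -/
theorem mul_log_div_lt_sub {c A B : ℝ} (hc : 0 ≤ c) (hA : 0 < A) (hcA : c ≤ A) (hAB : A < B) :
    c * Real.log (B / c) - c * Real.log (A / c) < B - A := by
  rcases hc.eq_or_lt with rfl | hc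
  · simpa using hAB
  have hB : 0 < B := hA.trans hAB
  rw [← mul_sub, ← Real.log_div (by positivity) (by positivity)]
  have h1 : B / c / (A / c) = B / A := by field_simp
  rw [h1]
  have h2 : Real.log (B / A) < B / A - 1 :=
    Real.log_lt_sub_one_of_pos (by positivity) (by rw [Ne, div_eq_one_iff_eq hA.ne']; exact hAB.ne')
  have h3 : B / A - 1 = (B - A) / A := by field_simp
  calc c * Real.log (B / A) < c * ((B - A) / A) := by rw [← h3]; gcongr
    _ ≤ A * ((B - A) / A) := by
      have : 0 ≤ (B - A) / A := div_nonneg (by linarith) hA.le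
      gcongr
    _ = B - A := by field_simp

theorem optValue_succ_le_of_le {k : ℕ} {A : ℝ} (hA0 : 0 < A) (hA : optValue k ≤ A)
    (h : 1 + optValue k + optValue k * Real.log (A / optValue k) ≤ A) :
    optValue (k + 1) ≤ A := by
  by_contra! hlt
  have h1 := mul_log_div_lt_sub (optValue_nonneg k) hA0 hA hlt
  have h2 := optValue_succ_eq k
  linarith

/-! ### Convexity and bounds of the optimal values -/

/-- For consecutive values `a < b`, the recursion says that the secant of `log` from `1` to `b / a`
has slope `1 - 1 / (b - a)`. If the next increment `d - b` were smaller, then `d / b < b / a`, and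
strict concavity would make the slope at `d / b` the larger one, forcing `d - b > b - a`. -/
theorem optValue_sub_le_sub {k : ℕ} (hk : 1 ≤ k) :
    (optValue (k + 1) : ℝ) - optValue k ≤ optValue (k + 2) - optValue (k + 1) := by
  obtain ⟨j, rfl⟩ := Nat.exists_eq_add_of_le' hk
  have hc : 0 < (optValue (j + 1) : ℝ) := one_pos.trans_le (one_le_optValue_succ j)
  have hc' := optValue_add_one_le_succ (j + 1)
  have hc'' := optValue_add_one_le_succ (j + 2)
  have e1 := optValue_succ_eq (j + 1)
  have e2 := optValue_succ_eq (j + 2)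
  change _ ≤ (optValue (j + 3) : ℝ) - optValue (j + 2)
  change _ + 1 ≤ (optValue (j + 2) : ℝ) at hc'
  change _ + 1 ≤ (optValue (j + 3) : ℝ) at hc''
  change (optValue (j + 2) : ℝ) = 1 + optValue (j + 1)
    + optValue (j + 1) * Real.log (optValue (j + 2) / optValue (j + 1)) at e1
  change (optValue (j + 3) : ℝ) = 1 + optValue (j + 2)
    + optValue (j + 2) * Real.log (optValue (j + 3) / optValue (j + 2)) at e2
  change (optValue (j + 2) : ℝ) - _ ≤ _
  generalize (optValue (j + 1) : ℝ) = a at *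
  generalize (optValue (j + 2) : ℝ) = b at *
  generalize (optValue (j + 3) : ℝ) = d at *
  by_contra! hlt
  have hb : 0 < b := by linarith
  have hr : d / b < b / a := by
    rw [div_lt_div_iff₀ hb hc]
    nlinarith
  have hr1 : 1 < d / b := by rw [one_lt_div hb]; linarith
  have key := strictConcaveOn_log_Ioi.secant_strict_mono (a := 1) (x := d / b) (y := b / a)
    (by simp) (by simp; linarith) (by simp; linarith) hr1.ne' (hr1.trans hr).ne' hr
  have l1 : Real.log (b / a) = (b - a - 1) / a := by field_simp; linarith
  have l2 : Real.log (d / b) = (d - b - 1) / b := by field_simp; linarith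
  have s1 : (Real.log (b / a) - Real.log 1) / (b / a - 1) = 1 - 1 / (b - a) := by
    have : b - a ≠ 0 := by linarith
    have h' : b / a - 1 = (b - a) / a := by field_simp
    rw [l1, Real.log_one, h']
    field_simp
    ring
  have s2 : (Real.log (d / b) - Real.log 1) / (d / b - 1) = 1 - 1 / (d - b) := by
    have : d - b ≠ 0 := by linarith
    have h' : d / b - 1 = (d - b) / b := by field_simp
    rw [l2, Real.log_one, h']
    field_simp
    ring
  rw [s1, s2] at key
  have : 1 / (b - a) ≤ 1 / (d - b) := one_div_le_one_div_of_le (by linarith) hlt.le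
  linarith

/-- Insert `2 * x / (x + 2) ≤ log (1 + x)` into the recursion, with `x` the increment divided by
`optValue k`, and clear denominators. -/
theorem two_mul_optValue_le {k : ℕ} : 2 * (optValue k : ℝ) ≤
    (optValue (k + 1) - optValue k) ^ 2 - (optValue (k + 1) - optValue k) := by
  have h1 := optValue_add_one_le_succ k
  have e := optValue_succ_eq k
  have h0 := optValue_nonneg k
  generalize (optValue (k + 1) : ℝ) = b at *
  generalize (optValue k : ℝ) = c at *
  rcases h0.eq_or_lt with rfl | hc
  · nlinarith
  have hx : 0 ≤ (b - c) / c := div_nonneg (by linarith) hc.le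
  have hl := Real.le_log_one_add_of_nonneg hx
  have h2 : 1 + (b - c) / c = b / c := by field_simp; ring
  have hl' := mul_le_mul_of_nonneg_left (h2 ▸ hl) hc.le
  have hp : 0 < b + c := by linarith
  have h3 : c * (2 * ((b - c) / c) / ((b - c) / c + 2)) = 2 * c * (b - c) / (b + c) := by
    have : (b - c) / c + 2 = (b + c) / c := by field_simp; ring
    rw [this]
    field_simp
  rw [h3, div_le_iff₀ hp] at hl'
  nlinarith

/-- The companion estimate, from `log r ≤ (r - r⁻¹) / 2`. -/
theorem sq_sub_two_mul_le {k : ℕ} :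
    (optValue (k + 1) - optValue k : ℝ) ^ 2 - 2 * (optValue (k + 1) - optValue k) ≤
      2 * optValue k := by
  have h1 := optValue_add_one_le_succ k
  have e := optValue_succ_eq k
  have h0 := optValue_nonneg k
  generalize (optValue (k + 1) : ℝ) = b at *
  generalize (optValue k : ℝ) = c at *
  rcases h0.eq_or_lt with rfl | hc
  · have : b = 1 := by simpa using e
    norm_num [this]
  have hb : 0 < b := by linarith
  have hlog : Real.log (b / c) ≤ (b / c - (b / c)⁻¹) / 2 := by
    rw [← Real.sinh_log (by positivity)]
    exact Real.self_le_sinh_iff.2 (Real.log_nonneg ((one_le_div hc).2 (by linarith)))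
  have hl' := mul_le_mul_of_nonneg_left hlog hc.le
  have h3 : c * ((b / c - (b / c)⁻¹) / 2) = (b ^ 2 - c ^ 2) / (2 * b) := by field_simp
  rw [h3, le_div_iff₀ (by positivity)] at hl'
  nlinarith

theorem sq_div_two_le_optValue (n : ℕ) : (n : ℝ) ^ 2 / 2 ≤ optValue n := by
  induction n with
  | zero => simp [optValue_zero]
  | succ n ih =>
    have h := two_mul_optValue_le (k := n)
    have h1 := optValue_add_one_le_succ n
    have hn : (0 : ℝ) ≤ n := n.cast_nonneg
    push_cast
    by_contra! hlt
    -- An increment `d < n + 1/2` gives `d * (d - 1) < n ^ 2`, against `two_mul_optValue_le`.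
    have : (optValue (n + 1) : ℝ) - optValue n < n + 1 / 2 := by nlinarith
    nlinarith

theorem optValue_le {n : ℕ} (hn : 2 ≤ n) :
    (optValue n : ℝ) ≤ (n : ℝ) ^ 2 / 2 + n * Real.log n := by
  induction n, hn using Nat.le_induction with
  | base =>
    have h2 : 0 < Real.log 2 := Real.log_pos one_lt_two
    push_cast
    refine optValue_succ_le_of_le (k := 1) (by positivity) ?_ ?_
    · rw [optValue_one]; linarith
    · rw [optValue_one]
      have : Real.log ((2 ^ 2 / 2 + 2 * Real.log 2) / 1) = Real.log 2 + Real.log (1 + Real.log 2) := by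
        rw [← Real.log_mul (by norm_num) (by positivity)]
        ring_nf
      rw [this]
      have := Real.log_le_sub_one_of_pos (x := 1 + Real.log 2) (by positivity)
      linarith
  | succ n hn ih =>
    have h := sq_sub_two_mul_le (k := n)
    have hn' : (2 : ℝ) ≤ n := by exact_mod_cast hn
    have hL : 0 ≤ Real.log n := Real.log_nonneg (by linarith)
    -- The claimed bound thus grows by at least `n + 3/2 + log n` from `n` to `n + 1`; an increment
    -- `d` exceeding this makes `d * (d - 2)` too large for `sq_sub_two_mul_le`.
    have hlog : 1 ≤ (n + 1) * (Real.log (n + 1) - Real.log n) := by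
      have h1 := Real.log_le_sub_one_of_pos (x := (n : ℝ) / (n + 1)) (by positivity)
      rw [Real.log_div (by positivity) (by positivity)] at h1
      have h2 : (n : ℝ) / (n + 1) - 1 = -(1 / (n + 1)) := by field_simp; ring
      have h3 : 1 / ((n : ℝ) + 1) ≤ Real.log (n + 1) - Real.log n := by linarith
      rwa [div_le_iff₀' (by positivity)] at h3
    push_cast
    by_contra! hlt
    have : (n : ℝ) + 3 / 2 + Real.log n < optValue (n + 1) - optValue n := by nlinarith
    nlinarith

/-! ### The value functions -/

/-- The uniform distribution on the unit interval. -/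
noncomputable def unif : Measure ℝ := volume.restrict (Set.Ioc 0 1)

/-- The optimal expected remaining time when `k` further values are to be selected
and the last selected value is `l`, for uniformly distributed observations. -/
noncomputable def valueFn (k : ℕ) (l : ℝ) : ENNReal :=
  ENNReal.ofReal (optValue k) / ENNReal.ofReal (1 - l)

/-- The optimal expected number of observations until `k` further values are selected, counting
at most `N` observations, when the last selected value is `l`. -/
noncomputable def horizonValue : ℕ → ℕ → ℝ → ENNReal
  | 0, _, _ => 0
  | _ + 1, 0, _ => 0
  | N + 1, k + 1, l => 1 + ∫⁻ x, (if l ≤ x then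
      min (horizonValue N (k + 1) l) (horizonValue N k x) else horizonValue N (k + 1) l) ∂unif

/-- The threshold below which the optimal policy selects a value exceeding `l` when `k + 1` further
values are to be selected. -/
noncomputable def threshold (k : ℕ) (l : ℝ) : ℝ := 1 - (1 - l) * (optValue k / optValue (k + 1))

instance : IsProbabilityMeasure unif := ⟨by simp [unif]⟩

theorem valueFn_zero (l : ℝ) : valueFn 0 l = 0 := by simp [valueFn, optValue_zero]

theorem valueFn_of_lt_one (k : ℕ) {l : ℝ} (hl : l < 1) :
    valueFn k l = ENNReal.ofReal (optValue k / (1 - l)) := by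
  rw [valueFn, ENNReal.ofReal_div_of_pos (by linarith)]

theorem measurable_valueFn (k : ℕ) : Measurable (valueFn k) := by
  unfold valueFn
  fun_prop

theorem measurable_horizonValue (N k : ℕ) : Measurable (horizonValue N k) := by
  induction N generalizing k with
  | zero => simp only [horizonValue]; exact measurable_const
  | succ N ih =>
    cases k with
    | zero => simp only [horizonValue]; exact measurable_const
    | succ k =>
      simp only [horizonValue]
      refine measurable_const.add (Measurable.lintegral_prod_right' (f := fun p : ℝ × ℝ =>
        if p.1 ≤ p.2 then min (horizonValue N (k + 1) p.1) (horizonValue N k p.2)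
        else horizonValue N (k + 1) p.1) ?_)
      exact Measurable.ite (measurableSet_le measurable_fst measurable_snd)
        (((ih _).comp measurable_fst).min ((ih _).comp measurable_snd))
        ((ih _).comp measurable_fst)

theorem monotone_horizonValue (k : ℕ) (l : ℝ) : Monotone fun N => horizonValue N k l := by
  refine monotone_nat_of_le_succ fun N => ?_
  induction N generalizing k l with
  | zero => exact zero_le
  | succ N ih =>
    cases k with
    | zero => simp [horizonValue]
    | succ k =>
      rw [horizonValue, horizonValue]
      gcongr with x
      split_ifs
      · exact min_le_min (ih _ _) (ih _ _)
      · exact ih _ _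

theorem ae_unif_mem_Ioo : ∀ᵐ x ∂unif, x ∈ Set.Ioo (0 : ℝ) 1 := by
  rw [unif, ← restrict_Ioo_eq_restrict_Ioc]
  exact ae_restrict_mem measurableSet_Ioo

theorem lintegral_unif_eq (f : ℝ → ENNReal) {l s : ℝ} (hl : 0 ≤ l) (hls : l ≤ s) (hs : s ≤ 1) :
    ∫⁻ x, f x ∂unif = (∫⁻ x in Set.Ioo 0 l, f x) + (∫⁻ x in Set.Ioc l s, f x) +
      ∫⁻ x in Set.Ioc s 1, f x := by
  rw [setLIntegral_congr Ioo_ae_eq_Ioc, ← lintegral_union measurableSet_Ioc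
    (Set.Ioc_disjoint_Ioc_of_le le_rfl), Set.Ioc_union_Ioc_eq_Ioc hl hls,
    ← lintegral_union measurableSet_Ioc (Set.Ioc_disjoint_Ioc_of_le le_rfl),
    Set.Ioc_union_Ioc_eq_Ioc (hl.trans hls) hs, unif]

theorem setLIntegral_valueFn (k : ℕ) {l s : ℝ} (hls : l ≤ s) (hs : s < 1) :
    ∫⁻ x in Set.Ioc l s, valueFn k x =
      ENNReal.ofReal (optValue k * Real.log ((1 - l) / (1 - s))) := by
  have hpos : ∀ x ∈ Set.Icc l s, 0 < 1 - x := fun x hx => by linarith [hx.2]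
  have hcont : ContinuousOn (fun x : ℝ => optValue k / (1 - x)) (Set.Icc l s) :=
    continuousOn_const.div (by fun_prop) fun x hx => (hpos x hx).ne'
  have hint : IntegrableOn (fun x : ℝ => optValue k / (1 - x)) (Set.Ioc l s) :=
    hcont.integrableOn_Icc.mono_set Set.Ioc_subset_Icc_self
  have h1 : ∫⁻ x in Set.Ioc l s, valueFn k x =
      ∫⁻ x in Set.Ioc l s, ENNReal.ofReal (optValue k / (1 - x)) :=
    setLIntegral_congr_fun measurableSet_Ioc fun x hx => valueFn_of_lt_one k (hx.2.trans_lt hs)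
  rw [h1, ← ofReal_integral_eq_lintegral_ofReal hint]
  · congr 1
    rw [← intervalIntegral.integral_of_le hls,
      intervalIntegral.integral_eq_sub_of_hasDerivAt
        (f := fun x : ℝ => -(optValue k * Real.log (1 - x)))]
    · rw [Real.log_div (hpos l ⟨le_rfl, hls⟩).ne' (hpos s ⟨hls, le_rfl⟩).ne']
      ring
    · intro x hx
      rw [Set.uIcc_of_le hls] at hx
      have h := (((hasDerivAt_id x).const_sub 1).log (hpos x hx).ne').const_mul (-(optValue k : ℝ))
      convert! h using 1
      · ext y; simp
      · simp only [id]; ring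
    · exact (intervalIntegrable_iff_integrableOn_Ioc_of_le hls).2 hint
  · filter_upwards [ae_restrict_mem measurableSet_Ioc] with x hx
    exact div_nonneg (optValue_nonneg k) (hpos x ⟨hx.1.le, hx.2⟩).le

/-- The Bellman step for the threshold rule. The ranges below `l`, up to the threshold and above it
contribute `l * V`, `v k * log (v (k+1) / v k)` and `v k`, where `V = v (k+1) / (1 - l)`; since `V =
l * V + v (k+1)`, this is the recursion. At `l = 1` the right side is `⊤`. -/
theorem one_add_lintegral_le_valueFn (k : ℕ) {l : ℝ} (hl0 : 0 ≤ l) (hl1 : l ≤ 1) :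
    1 + ∫⁻ x, (if l < x ∧ x ≤ threshold k l then valueFn k x else valueFn (k + 1) l) ∂unif ≤
      valueFn (k + 1) l := by
  have hv : 0 < (optValue (k + 1) : ℝ) := one_pos.trans_le (one_le_optValue_succ k)
  have hc := optValue_nonneg k
  have hcv := optValue_le_succ k
  rcases hl1.eq_or_lt with rfl | hl
  · have : valueFn (k + 1) 1 = ⊤ := by
      simp only [valueFn, sub_self, ENNReal.ofReal_zero]
      exact ENNReal.div_zero (by simpa using hv)
    rw [this]
    exact le_top
  have hq0 : 0 ≤ (optValue k : ℝ) / optValue (k + 1) := div_nonneg hc hv.le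
  have hq1 : (optValue k : ℝ) / optValue (k + 1) ≤ 1 := (div_le_one hv).2 hcv
  have hs1 : threshold k l ≤ 1 := by
    unfold threshold; nlinarith
  have hls : l ≤ threshold k l := by
    unfold threshold; nlinarith
  rw [lintegral_unif_eq _ hl0 hls hs1]
  have e1 : ∫⁻ x in Set.Ioo 0 l,
      (if l < x ∧ x ≤ threshold k l then valueFn k x else valueFn (k + 1) l) =
      ENNReal.ofReal (l * (optValue (k + 1) / (1 - l))) := by
    rw [setLIntegral_congr_fun (g := fun _ => valueFn (k + 1) l) measurableSet_Ioo
      fun x hx => if_neg fun h => h.1.not_gt hx.2]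
    rw [setLIntegral_const, Real.volume_Ioo, valueFn_of_lt_one _ hl, sub_zero, mul_comm,
      ENNReal.ofReal_mul hl0]
  have e2 : ∫⁻ x in Set.Ioc l (threshold k l),
      (if l < x ∧ x ≤ threshold k l then valueFn k x else valueFn (k + 1) l) =
      ENNReal.ofReal (optValue k * Real.log (optValue (k + 1) / optValue k)) := by
    have heq : Set.EqOn (fun x => if l < x ∧ x ≤ threshold k l then valueFn k x
        else valueFn (k + 1) l) (valueFn k) (Set.Ioc l (threshold k l)) := fun x hx => if_pos hx
    rw [setLIntegral_congr_fun measurableSet_Ioc heq]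
    rcases hc.eq_or_lt with h0 | h0
    · have : valueFn k = fun _ => 0 := by
        ext x; simp [valueFn, ← h0]
      simp [this, ← h0]
    · have : 0 < (1 - l) * (optValue k / optValue (k + 1)) :=
        mul_pos (by linarith) (div_pos h0 hv)
      rw [setLIntegral_valueFn k hls (by unfold threshold; linarith)]
      congr 3
      have : 1 - l ≠ 0 := by linarith
      unfold threshold
      field_simp
      ring
  have e3 : ∫⁻ x in Set.Ioc (threshold k l) 1,
      (if l < x ∧ x ≤ threshold k l then valueFn k x else valueFn (k + 1) l) =
      ENNReal.ofReal (optValue k) := by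
    rw [setLIntegral_congr_fun (g := fun _ => valueFn (k + 1) l) measurableSet_Ioc
      fun x hx => if_neg fun h => h.2.not_gt hx.1]
    rw [setLIntegral_const, Real.volume_Ioc, valueFn_of_lt_one _ hl,
      ← ENNReal.ofReal_mul (div_nonneg hv.le (by linarith))]
    congr 1
    have : 1 - l ≠ 0 := by linarith
    unfold threshold
    field_simp
    ring
  have hlog : 0 ≤ optValue k * Real.log (optValue (k + 1) / optValue k) := by
    rcases hc.eq_or_lt with h0 | h0
    · simp [← h0]
    · exact mul_nonneg h0.le (Real.log_nonneg ((one_le_div h0).2 hcv))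
  have hlv : 0 ≤ l * (optValue (k + 1) / (1 - l)) :=
    mul_nonneg hl0 (div_nonneg hv.le (by linarith))
  rw [e1, e2, e3, valueFn_of_lt_one _ hl, ← ENNReal.ofReal_one,
    ← ENNReal.ofReal_add hlv hlog, ← ENNReal.ofReal_add (by positivity) hc,
    ← ENNReal.ofReal_add zero_le_one (by positivity)]
  apply ENNReal.ofReal_le_ofReal
  have h := optValue_succ_eq k
  have h1 : (optValue (k + 1) : ℝ) / (1 - l) =
      l * (optValue (k + 1) / (1 - l)) + optValue (k + 1) := by
    have : 1 - l ≠ 0 := by linarith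
    field_simp
    ring
  linarith

/-- For finite `A`, evaluating the integral turns the hypothesis into the scalar supersolution
inequality for `A * (1 - l)`. -/
theorem valueFn_succ_le_of_bellman (k : ℕ) {l : ℝ} (hl0 : 0 ≤ l) (hl : l < 1) {A : ENNReal}
    (h : 1 + ∫⁻ x, (if l ≤ x then min A (valueFn k x) else A) ∂unif ≤ A) :
    valueFn (k + 1) l ≤ A := by
  induction A using ENNReal.recTopCoe with
  | top => exact le_top
  | coe a =>
  have hc := optValue_nonneg k
  have hl' : 0 < 1 - l := by linarith
  -- In the first case selecting never helps: the minimum is `a` almost everywhere, and the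
  -- hypothesis reads `1 + a ≤ a`.
  rcases le_or_gt ((a : ℝ) * (1 - l)) (optValue k) with hac | hac
  · exfalso
    have hle : (a : ENNReal) ≤ ∫⁻ x, (if l ≤ x then min (a : ENNReal) (valueFn k x) else a) ∂unif := by
      have : (a : ENNReal) = ∫⁻ _, (a : ENNReal) ∂unif := by simp
      conv_lhs => rw [this]
      refine lintegral_mono_ae ?_
      filter_upwards [ae_unif_mem_Ioo] with x hx
      split_ifs with hlx
      · refine le_min le_rfl ?_
        have h1 : (a : ENNReal) = ENNReal.ofReal a := by simp
        rw [valueFn_of_lt_one k hx.2, h1]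
        refine ENNReal.ofReal_le_ofReal ?_
        rw [le_div_iff₀ (by linarith [hx.2])]
        refine le_trans ?_ hac
        gcongr
      · exact le_rfl
    have h2 := (add_le_add_right hle 1).trans h
    have h3 : (a : ENNReal) < 1 + a := by
      rw [add_comm]; exact ENNReal.lt_add_right (by simp) one_ne_zero
    exact absurd h2 h3.not_ge
  · have ha : 0 < (a : ℝ) := by
      by_contra! h0
      nlinarith
    -- The point where `v k / (1 - x)` crosses the level `a`.
    set s : ℝ := 1 - optValue k / a with hs
    have hs1 : s ≤ 1 := by
      have : 0 ≤ (optValue k : ℝ) / a := by positivity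
      linarith
    have hls : l ≤ s := by
      have : (optValue k : ℝ) / a ≤ 1 - l := by rw [div_le_iff₀ ha]; linarith
      linarith
    have hA : (a : ENNReal) = ENNReal.ofReal a := by simp
    rw [lintegral_unif_eq _ hl0 hls hs1] at h
    have e1 : ∫⁻ x in Set.Ioo 0 l, (if l ≤ x then min (a : ENNReal) (valueFn k x) else a) =
        ENNReal.ofReal (l * a) := by
      rw [setLIntegral_congr_fun (g := fun _ => (a : ENNReal)) measurableSet_Ioo
        fun x hx => if_neg hx.2.not_ge]
      rw [setLIntegral_const, Real.volume_Ioo, sub_zero, mul_comm, ENNReal.ofReal_mul hl0, ← hA]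
    have e2 : ∫⁻ x in Set.Ioc l s, (if l ≤ x then min (a : ENNReal) (valueFn k x) else a) =
        ENNReal.ofReal (optValue k * Real.log (a * (1 - l) / optValue k)) := by
      have : Set.EqOn (fun x => if l ≤ x then min (a : ENNReal) (valueFn k x) else a)
          (valueFn k) (Set.Ioc l s) := by
        intro x hx
        simp only [if_pos hx.1.le]
        refine min_eq_right ?_
        rw [valueFn]
        refine ENNReal.div_le_of_le_mul ?_
        rw [hA, ← ENNReal.ofReal_mul a.coe_nonneg]
        refine ENNReal.ofReal_le_ofReal ?_
        have h1 : (optValue k : ℝ) / a ≤ 1 - x := by linarith [hx.2]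
        rwa [div_le_iff₀' ha] at h1
      rw [setLIntegral_congr_fun measurableSet_Ioc this]
      rcases hc.eq_or_lt with h0 | h0
      · have : valueFn k = fun _ => 0 := by
          ext x; simp [valueFn, ← h0]
        simp [this, ← h0]
      · have h1 : 0 < (optValue k : ℝ) / a := by positivity
        rw [setLIntegral_valueFn k hls (by linarith)]
        congr 3
        rw [hs]
        have : (optValue k : ℝ) ≠ 0 := h0.ne'
        field_simp
        ring_nf
        field_simp
    have e3 : ∫⁻ x in Set.Ioc s 1, (if l ≤ x then min (a : ENNReal) (valueFn k x) else a) =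
        ENNReal.ofReal (optValue k) := by
      have : Set.EqOn (fun x => if l ≤ x then min (a : ENNReal) (valueFn k x) else a)
          (fun _ => (a : ENNReal)) (Set.Ioo s 1) := by
        intro x hx
        simp only [if_pos (hls.trans hx.1.le)]
        refine min_eq_left ?_
        rw [valueFn_of_lt_one k hx.2, hA]
        refine ENNReal.ofReal_le_ofReal ?_
        have h1 : 1 - x ≤ (optValue k : ℝ) / a := by linarith [hx.1]
        rw [le_div_iff₀ (by linarith [hx.2]), mul_comm]
        rwa [le_div_iff₀ ha] at h1
      rw [← setLIntegral_congr Ioo_ae_eq_Ioc, setLIntegral_congr_fun measurableSet_Ioo this,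
        setLIntegral_const, Real.volume_Ioo, hA,
        ← ENNReal.ofReal_mul a.coe_nonneg]
      congr 1
      rw [hs]
      field_simp
      ring
    have hlog : 0 ≤ optValue k * Real.log (a * (1 - l) / optValue k) := by
      rcases hc.eq_or_lt with h0 | h0
      · simp [← h0]
      · exact mul_nonneg h0.le (Real.log_nonneg ((one_le_div h0).2 hac.le))
    have hla : 0 ≤ l * a := mul_nonneg hl0 ha.le
    rw [e1, e2, e3, hA, ← ENNReal.ofReal_one, ← ENNReal.ofReal_add hla hlog,
      ← ENNReal.ofReal_add (by positivity) hc,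
      ← ENNReal.ofReal_add zero_le_one (by positivity), ENNReal.ofReal_le_ofReal_iff ha.le] at h
    rw [valueFn_of_lt_one _ hl, hA]
    refine ENNReal.ofReal_le_ofReal ?_
    rw [div_le_iff₀ hl']
    exact optValue_succ_le_of_le (by positivity) hac.le (by linarith)

/-- Monotone convergence in the horizon; the minimum of two increasing suprema is the supremum of
the minima. -/
theorem one_add_lintegral_iSup_horizonValue_le (k : ℕ) (l : ℝ) :
    1 + ∫⁻ x, (if l ≤ x then min (⨆ N, horizonValue N (k + 1) l) (⨆ N, horizonValue N k x)
      else ⨆ N, horizonValue N (k + 1) l) ∂unif ≤ ⨆ N, horizonValue N (k + 1) l := by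
  have h1 : ∀ x, (if l ≤ x then min (⨆ N, horizonValue N (k + 1) l) (⨆ N, horizonValue N k x)
      else ⨆ N, horizonValue N (k + 1) l) = ⨆ N, (if l ≤ x then
        min (horizonValue N (k + 1) l) (horizonValue N k x) else horizonValue N (k + 1) l) := by
    intro x
    split_ifs
    · exact (iSup_inf_of_monotone (monotone_horizonValue _ _) (monotone_horizonValue _ _)).symm
    · rfl
  simp_rw [h1]
  rw [lintegral_iSup, ENNReal.add_iSup]
  · refine iSup_le fun N => ?_
    exact le_iSup (fun N => horizonValue N (k + 1) l) (N + 1)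
  · intro N
    exact Measurable.ite measurableSet_Ici
      (measurable_const.min (measurable_horizonValue N k)) measurable_const
  · intro N M hNM x
    dsimp only
    split_ifs
    · exact min_le_min (monotone_horizonValue _ _ hNM) (monotone_horizonValue _ _ hNM)
    · exact monotone_horizonValue _ _ hNM

theorem valueFn_le_iSup_horizonValue (k : ℕ) {l : ℝ} (hl0 : 0 ≤ l) (hl : l < 1) :
    valueFn k l ≤ ⨆ N, horizonValue N k l := by
  induction k generalizing l with
  | zero => simp [valueFn_zero]
  | succ k ih =>
    refine valueFn_succ_le_of_bellman k hl0 hl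
      (le_trans ?_ (one_add_lintegral_iSup_horizonValue_le k l))
    refine add_le_add_right (lintegral_mono_ae ?_) 1
    filter_upwards [ae_unif_mem_Ioo] with x hx
    split_ifs
    · exact min_le_min le_rfl (ih hx.1.le hx.2)
    · exact le_rfl

/-! ### The probability integral transform -/

theorem continuous_cdf {F : Measure ℝ} [IsProbabilityMeasure F] (hF : ∀ x, F {x} = 0) :
    Continuous (cdf F) := by
  refine continuous_iff_continuousAt.2 fun x => ?_
  rw [(monotone_cdf F).continuousAt_iff_leftLim_eq_rightLim, StieltjesFunction.rightLim_eq]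
  have h := hF x
  rw [← measure_cdf F, StieltjesFunction.measure_singleton, ENNReal.ofReal_eq_zero] at h
  exact le_antisymm ((monotone_cdf F).leftLim_le le_rfl) (by linarith)

/-- The sublevel set is a closed half-line, and by continuity the distribution function equals `t`
at its endpoint, even if it is flat there. -/
theorem measure_cdf_le {F : Measure ℝ} [IsProbabilityMeasure F] (hF : ∀ x, F {x} = 0)
    {t : ℝ} (ht0 : 0 < t) (ht1 : t < 1) : F {x | cdf F x ≤ t} = ENNReal.ofReal t := by
  have hcont := continuous_cdf hF
  obtain ⟨a, ha⟩ := ((tendsto_cdf_atBot F).eventually (gt_mem_nhds ht0)).exists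
  obtain ⟨b, hb⟩ := ((tendsto_cdf_atTop F).eventually (lt_mem_nhds ht1)).exists
  obtain ⟨y, hy⟩ := mem_range_of_exists_le_of_exists_ge hcont ⟨a, ha.le⟩ ⟨b, hb.le⟩
  have hbdd : BddAbove {x | cdf F x ≤ t} :=
    ⟨b, fun x hx => le_of_not_gt fun h => (hb.trans_le (monotone_cdf F h.le)).not_ge hx⟩
  have hmem : sSup {x | cdf F x ≤ t} ∈ {x | cdf F x ≤ t} :=
    (isClosed_le hcont continuous_const).csSup_mem ⟨y, hy.le⟩ hbdd
  have hset : {x | cdf F x ≤ t} = Set.Iic (sSup {x | cdf F x ≤ t}) :=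
    Set.ext fun x => ⟨fun hx => le_csSup hbdd hx, fun hx => (monotone_cdf F hx).trans hmem⟩
  have heq : cdf F (sSup {x | cdf F x ≤ t}) = t :=
    le_antisymm hmem (hy.symm.le.trans (monotone_cdf F (le_csSup hbdd hy.le)))
  rw [hset, ← ofReal_cdf, heq]

theorem unif_Iic {t : ℝ} (ht1 : t ≤ 1) : unif (Set.Iic t) = ENNReal.ofReal t := by
  rw [unif, Measure.restrict_apply measurableSet_Iic, Set.inter_comm, Set.Ioc_inter_Iic,
    min_eq_right ht1, Real.volume_Ioc, sub_zero]

theorem map_cdf_eq_unif {F : Measure ℝ} [IsProbabilityMeasure F] (hF : ∀ x, F {x} = 0) :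
    F.map (cdf F) = unif := by
  have hm : Measurable (cdf F) := (monotone_cdf F).measurable
  have : IsProbabilityMeasure (F.map (cdf F)) := Measure.isProbabilityMeasure_map hm.aemeasurable
  refine Measure.ext_of_Iic _ _ fun t => ?_
  rw [Measure.map_apply hm measurableSet_Iic]
  change F {x | cdf F x ≤ t} = _
  rcases lt_or_ge 0 t with ht0 | ht0
  · rcases lt_or_ge t 1 with ht1 | ht1
    · rw [measure_cdf_le hF ht0 ht1, unif_Iic ht1.le]
    · have h1 : {x | cdf F x ≤ t} = Set.univ := Set.eq_univ_of_forall fun x =>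
        (cdf_le_one F x).trans ht1
      have h2 : 1 ≤ unif (Set.Iic t) := by
        rw [← ENNReal.ofReal_one, ← unif_Iic le_rfl]
        exact measure_mono (Set.Iic_subset_Iic.2 ht1)
      rw [h1, measure_univ]
      exact le_antisymm h2 prob_le_one
  · have h1 : unif (Set.Iic t) = 0 := by
      refine measure_mono_null (Set.Iic_subset_Iic.2 ht0) ?_
      rw [unif_Iic zero_le_one, ENNReal.ofReal_zero]
    rw [h1]
    -- At level `0` the sublevel set may be empty, so it is squeezed into those of small positive
    -- level.
    refine le_antisymm (ENNReal.le_of_forall_pos_le_add fun ε hε _ => ?_) zero_le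
    rw [zero_add]
    have hδ : 0 < min (ε : ℝ) (1 / 2) := lt_min hε (by norm_num)
    calc F {x | cdf F x ≤ t} ≤ F {x | cdf F x ≤ min (ε : ℝ) (1 / 2)} :=
          measure_mono fun x hx => le_trans hx (ht0.trans hδ.le)
      _ = ENNReal.ofReal (min (ε : ℝ) (1 / 2)) :=
          measure_cdf_le hF hδ ((min_le_right _ _).trans_lt (by norm_num))
      _ ≤ ENNReal.ofReal ε := ENNReal.ofReal_le_ofReal (min_le_left _ _)
      _ = ε := ENNReal.ofReal_coe_nnreal

/-! ### Sequential selection from a stream of uniform observations -/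

variable {Ω : Type*} {m : MeasurableSpace Ω}

/-- `U 1, U 2, …` are adapted to `𝓕` and uniform, and each one is independent of the past. -/
structure IsUniformStream (μ : Measure Ω) (𝓕 : Filtration ℕ m) (U : ℕ → Ω → ℝ) : Prop where
  adapted : ∀ i, Measurable[𝓕 (i + 1)] (U (i + 1))
  mem_Icc : ∀ i ω, U (i + 1) ω ∈ Set.Icc (0 : ℝ) 1
  map_eq : ∀ i, μ.map (U (i + 1)) = unif
  indep : ∀ i, Indep (𝓕 i) (MeasurableSpace.comap (U (i + 1)) inferInstance) μ

theorem isUniformStream_cdf {μ : Measure Ω} [IsProbabilityMeasure μ] {X : ℕ → Ω → ℝ}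
    (hX : ∀ i, 1 ≤ i → Measurable (X i)) (hindep : iIndepFun (fun i : ℕ => X (i + 1)) μ)
    {F : Measure ℝ} [IsProbabilityMeasure F] (hF : ∀ x, F {x} = 0)
    (hlaw : ∀ i, 1 ≤ i → μ.map (X i) = F) :
    IsUniformStream μ (obsFiltration X hX) fun i ω => cdf F (X i ω) where
  adapted i := (monotone_cdf F).measurable.comp <|
    (comap_measurable (X (i + 1))).mono (le_iSup₂_of_le (f := fun j (_ : j ∈ Set.Icc 1 (i + 1)) =>
      MeasurableSpace.comap (X j) inferInstance) (i + 1) ⟨by simp, le_rfl⟩ le_rfl) le_rfl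
  mem_Icc i ω := ⟨cdf_nonneg F _, cdf_le_one F _⟩
  map_eq i := by
    rw [← map_cdf_eq_unif hF, ← hlaw (i + 1) (by simp),
      Measure.map_map (by rw [hlaw (i + 1) (by simp)]; exact (monotone_cdf F).measurable)
        (hX _ (by simp))]
    rw [hlaw (i + 1) (by simp)]
    rfl
  indep i := by
    have h := indep_iSup_of_disjoint
      (m := fun j => MeasurableSpace.comap (X (j + 1)) inferInstance)
      (fun j => (hX (j + 1) (by simp)).comap_le) hindep (S := Set.Iio i) (T := {i}) (by simp)
    refine indep_of_indep_of_le_left (indep_of_indep_of_le_right h ?_) ?_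
    · simp only [Set.mem_singleton_iff, iSup_iSup_eq_left]
      change MeasurableSpace.comap (cdf F ∘ X (i + 1)) _ ≤ _
      rw [← MeasurableSpace.comap_comp]
      exact MeasurableSpace.comap_mono (monotone_cdf F).measurable.comap_le
    · refine iSup₂_le fun j hj => ?_
      obtain ⟨j, rfl⟩ := Nat.exists_eq_add_of_le' hj.1
      exact le_iSup₂_of_le (f := fun j (_ : j ∈ Set.Iio i) =>
        MeasurableSpace.comap (X (j + 1)) inferInstance) j (Nat.lt_of_succ_le hj.2) le_rfl

/-- The Markov step: a state known at time `i` is independent of the next observation, so their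
joint law is a product and Fubini applies. -/
theorem IsUniformStream.lintegral_comp {μ : Measure Ω} [IsProbabilityMeasure μ]
    {𝓕 : Filtration ℕ m} {U : ℕ → Ω → ℝ} (hU : IsUniformStream μ 𝓕 U) {i : ℕ}
    {S : Ω → ℕ × ℝ} (hS : Measurable[𝓕 i] S) {h : (ℕ × ℝ) × ℝ → ENNReal} (hh : Measurable h) :
    ∫⁻ ω, h (S ω, U (i + 1) ω) ∂μ = ∫⁻ ω, ∫⁻ x, h (S ω, x) ∂unif ∂μ := by
  have hS' : Measurable S := hS.mono (𝓕.le i) le_rfl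
  have hU' : Measurable (U (i + 1)) := (hU.adapted i).mono (𝓕.le _) le_rfl
  have hind : IndepFun S (U (i + 1)) μ := by
    rw [IndepFun_iff_Indep]
    exact indep_of_indep_of_le_left (hU.indep i) hS.comap_le
  have hmap := (indepFun_iff_map_prod_eq_prod_map_map hS'.aemeasurable hU'.aemeasurable).1 hind
  rw [← lintegral_map (μ := μ) (f := h) (g := fun ω => (S ω, U (i + 1) ω)) hh (hS'.prodMk hU'),
    hmap, hU.map_eq, lintegral_prod _ hh.aemeasurable, lintegral_map hh.lintegral_prod_right' hS']

/-- The number of the values selected up to time `i`, and the last of them, if the observation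
`U (i + 1)` is selected whenever `D i s ω` holds, where `s` is the state at time `i`. -/
noncomputable def selState (U : ℕ → Ω → ℝ) (D : ℕ → ℕ × ℝ → Ω → Prop) : ℕ → Ω → ℕ × ℝ
  | 0, _ => (0, 0)
  | i + 1, ω =>
    open Classical in
    if D i (selState U D i ω) ω then ((selState U D i ω).1 + 1, U (i + 1) ω)
    else selState U D i ω

section selState

variable {U : ℕ → Ω → ℝ} {D : ℕ → ℕ × ℝ → Ω → Prop} {i : ℕ} {ω : Ω}

theorem selState_succ_of_pos (h : D i (selState U D i ω) ω) :
    selState U D (i + 1) ω = ((selState U D i ω).1 + 1, U (i + 1) ω) := if_pos h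

theorem selState_succ_of_neg (h : ¬ D i (selState U D i ω) ω) :
    selState U D (i + 1) ω = selState U D i ω := if_neg h

theorem selState_fst_le_succ : (selState U D i ω).1 ≤ (selState U D (i + 1) ω).1 := by
  by_cases h : D i (selState U D i ω) ω
  · rw [selState_succ_of_pos h]; exact Nat.le_succ _
  · rw [selState_succ_of_neg h]

theorem selState_fst_succ_le : (selState U D (i + 1) ω).1 ≤ (selState U D i ω).1 + 1 := by
  by_cases h : D i (selState U D i ω) ω
  · rw [selState_succ_of_pos h]
  · rw [selState_succ_of_neg h]; exact Nat.le_succ _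

theorem monotone_selState_fst : Monotone fun i => (selState U D i ω).1 :=
  monotone_nat_of_le_succ fun _ => selState_fst_le_succ

theorem measurable_selState {𝓕 : Filtration ℕ m} (hU : ∀ i, Measurable[𝓕 (i + 1)] (U (i + 1)))
    (hD : ∀ i, Measurable[𝓕 i] (selState U D i) →
      MeasurableSet[𝓕 (i + 1)] {ω | D i (selState U D i ω) ω}) (i : ℕ) :
    Measurable[𝓕 i] (selState U D i) := by
  classical
  induction i with
  | zero => exact @measurable_const _ _ _ (𝓕 0) _
  | succ i ih =>
    have h := ih.mono (𝓕.mono i.le_succ) le_rfl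
    exact Measurable.ite (hD i ih)
      (Measurable.prodMk ((measurable_of_countable (· + 1)).comp (measurable_fst.comp h)) (hU i)) h

theorem selState_snd_mem_Icc (hU : ∀ i ω, U (i + 1) ω ∈ Set.Icc (0 : ℝ) 1) (i : ℕ) (ω : Ω) :
    (selState U D i ω).2 ∈ Set.Icc (0 : ℝ) 1 := by
  induction i with
  | zero => simp [selState]
  | succ i ih =>
    by_cases h : D i (selState U D i ω) ω
    · rw [selState_succ_of_pos h]; exact hU i ω
    · rwa [selState_succ_of_neg h]

end selState

theorem measurable_uncurry_nat {f : ℕ → ℝ → ENNReal} (hf : ∀ k, Measurable (f k)) :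
    Measurable fun p : ℕ × ℝ => f p.1 p.2 :=
  measurable_from_prod_countable_right hf

/-- A selection rule that always exceeds the last selected value, and selects at most `n` values,
does not reach `n` values quicker than the finite horizon value. -/
theorem horizonValue_le_sum {μ : Measure Ω} [IsProbabilityMeasure μ] {𝓕 : Filtration ℕ m}
    {U : ℕ → Ω → ℝ} (hU : IsUniformStream μ 𝓕 U) {D : ℕ → ℕ × ℝ → Ω → Prop} {n : ℕ}
    (hS : ∀ i, Measurable[𝓕 i] (selState U D i))
    (hD : ∀ᵐ ω ∂μ, ∀ i, D i (selState U D i ω) ω →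
      (selState U D i ω).1 < n ∧ (selState U D i ω).2 ≤ U (i + 1) ω) (N i : ℕ) :
    ∫⁻ ω, horizonValue N (n - (selState U D i ω).1) (selState U D i ω).2 ∂μ ≤
      ∑ j ∈ Finset.range N, ∫⁻ ω, (if (selState U D (i + j) ω).1 < n then 1 else 0) ∂μ := by
  induction N generalizing i with
  | zero => simp [horizonValue]
  | succ N ih =>
    have hm1 : Measurable fun p : ℕ × ℝ => horizonValue N (n - p.1) p.2 :=
      measurable_uncurry_nat (f := fun k => horizonValue N (n - k))
        fun k => measurable_horizonValue _ _
    have hm2 : Measurable fun p : ℕ × ℝ => horizonValue N (n - p.1 - 1) p.2 :=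
      measurable_uncurry_nat (f := fun k => horizonValue N (n - k - 1))
        fun k => measurable_horizonValue _ _
    -- The Bellman integrand as a function of state and next observation: averaging over a fresh
    -- uniform value gives `horizonValue (N + 1)`, while along the actual path the minimum is at
    -- most the branch that the rule takes.
    let h : (ℕ × ℝ) × ℝ → ENNReal := fun p => if p.1.1 < n then 1 + (if p.1.2 ≤ p.2 then
      min (horizonValue N (n - p.1.1) p.1.2) (horizonValue N (n - p.1.1 - 1) p.2)
      else horizonValue N (n - p.1.1) p.1.2) else 0
    have hh : Measurable h := by
      refine Measurable.ite ?_ ?_ measurable_const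
      · exact measurableSet_lt (measurable_fst.comp measurable_fst) measurable_const
      refine Measurable.const_add (Measurable.ite ?_ ?_ ?_) 1
      · exact measurableSet_le (measurable_snd.comp measurable_fst) measurable_snd
      · exact (hm1.comp measurable_fst).min
          (hm2.comp ((measurable_fst.comp measurable_fst).prodMk measurable_snd))
      · exact hm1.comp measurable_fst
    have e : ∀ s : ℕ × ℝ, horizonValue (N + 1) (n - s.1) s.2 = ∫⁻ x, h (s, x) ∂unif := by
      intro s
      simp only [h]
      by_cases hs : s.1 < n
      · obtain ⟨k, hk⟩ := Nat.exists_eq_add_of_lt hs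
        have h1 : n - s.1 = k + 1 := by omega
        simp only [hs, if_true, h1, Nat.add_sub_cancel]
        rw [horizonValue, lintegral_add_left measurable_const, lintegral_const, measure_univ,
          mul_one]
      · simp only [hs, if_false, lintegral_zero, Nat.sub_eq_zero_of_le (not_lt.1 hs)]
        rfl
    have hmI : Measurable fun ω => if (selState U D i ω).1 < n then (1 : ENNReal) else 0 := by
      refine Measurable.ite (measurableSet_lt ?_ measurable_const) measurable_const measurable_const
      exact measurable_fst.comp ((hS i).mono (𝓕.le i) le_rfl)
    simp_rw [e]
    rw [← hU.lintegral_comp (hS i) hh, Finset.sum_range_succ', add_comm (Finset.sum _ _)]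
    have hstep : ∫⁻ ω, h (selState U D i ω, U (i + 1) ω) ∂μ ≤
        ∫⁻ ω, (if (selState U D i ω).1 < n then 1 else 0) +
          horizonValue N (n - (selState U D (i + 1) ω).1) (selState U D (i + 1) ω).2 ∂μ := by
      refine lintegral_mono_ae ?_
      filter_upwards [hD] with ω hω
      simp only [h]
      split_ifs with h1 h2
      · gcongr
        by_cases hd : D i (selState U D i ω) ω
        · rw [selState_succ_of_pos hd, ← Nat.sub_sub]
          exact min_le_right _ _
        · rw [selState_succ_of_neg hd]
          exact min_le_left _ _
      · rw [selState_succ_of_neg fun hd => h2 (hω i hd).2]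
      · exact zero_le
    rw [lintegral_add_left hmI] at hstep
    refine hstep.trans (add_le_add le_rfl ((ih (i + 1)).trans_eq ?_))
    refine Finset.sum_congr rfl fun j _ => ?_
    rw [add_right_comm, add_assoc]

theorem measurable_threshold (k : ℕ) : Measurable (threshold k) := by
  unfold threshold
  generalize (optValue k : ℝ) / optValue (k + 1) = q
  fun_prop

theorem measurable_threshold_sub (n : ℕ) :
    Measurable fun p : ℕ × ℝ => threshold (n - p.1 - 1) p.2 :=
  measurable_from_prod_countable_right (f := fun p : ℕ × ℝ => threshold (n - p.1 - 1) p.2)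
    fun k => measurable_threshold (n - k - 1)

/-- The optimal selection rule for `n` values. -/
def OptRule (U : ℕ → Ω → ℝ) (n i : ℕ) (s : ℕ × ℝ) (ω : Ω) : Prop :=
  s.1 < n ∧ s.2 < U (i + 1) ω ∧ U (i + 1) ω ≤ threshold (n - s.1 - 1) s.2

theorem measurable_selState_optRule {𝓕 : Filtration ℕ m} {U : ℕ → Ω → ℝ}
    (hU : ∀ i, Measurable[𝓕 (i + 1)] (U (i + 1))) (n i : ℕ) :
    Measurable[𝓕 i] (selState U (OptRule U n) i) := by
  refine measurable_selState hU (fun i hi => ?_) i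
  have h := hi.mono (𝓕.mono i.le_succ) le_rfl
  have ht := measurable_threshold_sub n
  exact (measurableSet_lt (measurable_fst.comp h) measurable_const).inter
    ((measurableSet_lt (measurable_snd.comp h) (hU i)).inter (measurableSet_le (hU i) (ht.comp h)))

/-- A supermartingale estimate in integrated form; each step is `one_add_lintegral_le_valueFn`. -/
theorem sum_add_lintegral_valueFn_le {μ : Measure Ω} [IsProbabilityMeasure μ]
    {𝓕 : Filtration ℕ m} {U : ℕ → Ω → ℝ} (hU : IsUniformStream μ 𝓕 U) (n N : ℕ) :
    ∑ j ∈ Finset.range N, ∫⁻ ω, (if (selState U (OptRule U n) j ω).1 < n then 1 else 0) ∂μ +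
      ∫⁻ ω, valueFn (n - (selState U (OptRule U n) N ω).1) (selState U (OptRule U n) N ω).2 ∂μ ≤
      valueFn n 0 := by
  induction N with
  | zero => simp [selState]
  | succ N ih =>
    have hS := measurable_selState_optRule hU.adapted n
    have hm1 : Measurable fun p : ℕ × ℝ => valueFn (n - p.1) p.2 :=
      measurable_uncurry_nat (f := fun k => valueFn (n - k)) fun k => measurable_valueFn _
    have hm2 : Measurable fun p : ℕ × ℝ => valueFn (n - p.1 - 1) p.2 :=
      measurable_uncurry_nat (f := fun k => valueFn (n - k - 1)) fun k => measurable_valueFn _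
    have ht := measurable_threshold_sub n
    let h : (ℕ × ℝ) × ℝ → ENNReal := fun p => if p.1.1 < n then 1 +
      (if p.1.2 < p.2 ∧ p.2 ≤ threshold (n - p.1.1 - 1) p.1.2 then valueFn (n - p.1.1 - 1) p.2
      else valueFn (n - p.1.1) p.1.2) else 0
    have hh : Measurable h := by
      refine Measurable.ite ?_ ?_ measurable_const
      · exact measurableSet_lt (measurable_fst.comp measurable_fst) measurable_const
      refine Measurable.const_add (Measurable.ite ?_ ?_ ?_) 1
      · exact (measurableSet_lt (measurable_snd.comp measurable_fst) measurable_snd).inter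
          (measurableSet_le measurable_snd (ht.comp measurable_fst))
      · exact hm2.comp ((measurable_fst.comp measurable_fst).prodMk measurable_snd)
      · exact hm1.comp measurable_fst
    have hmI : Measurable fun ω =>
        if (selState U (OptRule U n) N ω).1 < n then (1 : ENNReal) else 0 := by
      refine Measurable.ite (measurableSet_lt ?_ measurable_const) measurable_const measurable_const
      exact measurable_fst.comp ((hS N).mono (𝓕.le N) le_rfl)
    refine le_trans ?_ ih
    rw [Finset.sum_range_succ, add_assoc, ← lintegral_add_left hmI]
    refine add_le_add le_rfl ?_
    have hstep : ∀ ω, (if (selState U (OptRule U n) N ω).1 < n then (1 : ENNReal) else 0) +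
        valueFn (n - (selState U (OptRule U n) (N + 1) ω).1)
          (selState U (OptRule U n) (N + 1) ω).2 =
        h (selState U (OptRule U n) N ω, U (N + 1) ω) := by
      intro ω
      simp only [h]
      by_cases hd : OptRule U n N (selState U (OptRule U n) N ω) ω
      · rw [selState_succ_of_pos hd, if_pos hd.1, if_pos hd.1, if_pos hd.2, ← Nat.sub_sub]
      · rw [selState_succ_of_neg hd]
        split_ifs with h1 h2
        · exact absurd ⟨h1, h2⟩ hd
        · rfl
        · rw [Nat.sub_eq_zero_of_le (not_lt.1 h1), valueFn_zero, add_zero]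
    simp_rw [hstep]
    rw [hU.lintegral_comp (hS N) hh]
    refine lintegral_mono fun ω => ?_
    simp only [h]
    by_cases hs : (selState U (OptRule U n) N ω).1 < n
    · obtain ⟨k, hk⟩ := Nat.exists_eq_add_of_lt hs
      have h1 : n - (selState U (OptRule U n) N ω).1 = k + 1 := by omega
      have h2 := selState_snd_mem_Icc (D := OptRule U n) hU.mem_Icc N ω
      simp only [hs, if_true, h1, Nat.add_sub_cancel]
      rw [lintegral_add_left measurable_const, lintegral_const, measure_univ, mul_one]
      exact one_add_lintegral_le_valueFn k h2.1 h2.2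
    · simp [hs]

theorem enat_toENNReal_eq_tsum (t : ℕ∞) :
    (t : ENNReal) = ∑' j : ℕ, if (j : ℕ∞) < t then 1 else 0 := by
  induction t using ENat.recTopCoe with
  | top => simp
  | coe t =>
    rw [tsum_eq_sum (s := Finset.range t) fun j hj => by simpa using hj]
    rw [Finset.sum_congr rfl (g := fun _ => 1) fun j hj => by simpa using hj]
    simp

/-! ### The lower bound for arbitrary policies -/

/-- A pathwise dictionary: the rule "select at the times `t k`" makes the state count the selection
times passed so far and remember the value taken at the latest one. -/
theorem selState_of_selection_times {U : ℕ → Ω → ℝ} {D : ℕ → ℕ × ℝ → Ω → Prop} {n : ℕ} {ω : Ω}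
    {t : ℕ → ℕ} (hD : ∀ i s, D i s ω ↔ ∃ k ∈ Set.Icc 1 n, t k = i + 1)
    (h1 : ∀ k ∈ Set.Icc 1 n, 1 ≤ t k) (ht : ∀ k, 1 ≤ k → k < n → t k < t (k + 1)) (i : ℕ) :
    (selState U D i ω).1 ≤ n ∧ (∀ k ∈ Set.Icc 1 n, t k ≤ i ↔ k ≤ (selState U D i ω).1) ∧
      (1 ≤ (selState U D i ω).1 → (selState U D i ω).2 = U (t (selState U D i ω).1) ω) ∧
      (D i (selState U D i ω) ω →
        (selState U D i ω).1 < n ∧ t ((selState U D i ω).1 + 1) = i + 1) := by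
  have hmono : ∀ j k, 1 ≤ j → j < k → k ≤ n → t j < t k := by
    intro j k hj hjk
    induction k, hjk using Nat.le_induction with
    | base => exact fun hk => ht j hj hk
    | succ k hk ih => exact fun hkn => (ih (by omega)).trans (ht k (by omega) (by omega))
  have hnext : ∀ i, (∀ k ∈ Set.Icc 1 n, t k ≤ i ↔ k ≤ (selState U D i ω).1) →
      D i (selState U D i ω) ω →
      (selState U D i ω).1 < n ∧ t ((selState U D i ω).1 + 1) = i + 1 := by
    intro i hi hd
    obtain ⟨j, hj, hji⟩ := (hD _ _).1 hd
    have h2 : ¬ j ≤ (selState U D i ω).1 := fun h => by have := (hi j hj).2 h; omega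
    have hj1 := hj.1
    have hj2 := hj.2
    have h3 : j = (selState U D i ω).1 + 1 := by
      by_contra hne
      have h4 := hmono ((selState U D i ω).1 + 1) j (by omega) (by omega) hj.2
      have h5 := (hi ((selState U D i ω).1 + 1) ⟨by omega, by omega⟩).1 (by omega)
      omega
    exact ⟨by omega, h3 ▸ hji⟩
  suffices h : (selState U D i ω).1 ≤ n ∧
      (∀ k ∈ Set.Icc 1 n, t k ≤ i ↔ k ≤ (selState U D i ω).1) ∧
      (1 ≤ (selState U D i ω).1 → (selState U D i ω).2 = U (t (selState U D i ω).1) ω) from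
    ⟨h.1, h.2.1, h.2.2, hnext i h.2.1⟩
  induction i with
  | zero =>
    refine ⟨by simp [selState], fun k hk => ?_, by simp [selState]⟩
    have := h1 k hk
    have := hk.1
    simp only [selState]
    omega
  | succ i ih =>
    obtain ⟨hn, hi, hL⟩ := ih
    by_cases hd : D i (selState U D i ω) ω
    · obtain ⟨hlt, heq⟩ := hnext i hi hd
      rw [selState_succ_of_pos hd]
      refine ⟨hlt, fun k hk => ⟨fun hki => ?_, fun hk' => ?_⟩, fun _ => by rw [heq]⟩
      · by_contra hcon
        have := hmono ((selState U D i ω).1 + 1) k (by omega) (not_le.1 hcon) hk.2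
        omega
      · rcases hk'.eq_or_lt with h | h
        · rw [h, heq]
        · exact heq ▸ (hmono k _ hk.1 h hlt).le
    · rw [selState_succ_of_neg hd]
      refine ⟨hn, fun k hk => ?_, hL⟩
      rw [← hi k hk]
      have : t k ≠ i + 1 := fun h => hd ((hD _ _).2 ⟨k, hk, h⟩)
      omega

theorem optValue_le_of_isSelectionPolicy {μ : Measure Ω} [IsProbabilityMeasure μ] {X : ℕ → Ω → ℝ}
    {hX : ∀ i, 1 ≤ i → Measurable (X i)} (hindep : iIndepFun (fun i : ℕ => X (i + 1)) μ)
    {F : Measure ℝ} [IsProbabilityMeasure F] (hF : ∀ x, F {x} = 0)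
    (hlaw : ∀ i, 1 ≤ i → μ.map (X i) = F) {n : ℕ} (hn : 1 ≤ n) {τ : ℕ → Ω → ℕ∞}
    (hτ : IsSelectionPolicy X hX μ n τ) :
    ENNReal.ofReal (optValue n) ≤ ∫⁻ ω, (τ n ω : ENNReal) ∂μ := by
  have hU := isUniformStream_cdf hX hindep hF hlaw
  set U : ℕ → Ω → ℝ := fun i ω => cdf F (X i ω) with hUdef
  let D : ℕ → ℕ × ℝ → Ω → Prop := fun i _ ω => ∃ k ∈ Set.Icc 1 n, τ k ω = ((i + 1 : ℕ) : ℕ∞)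
  have hS : ∀ i, Measurable[obsFiltration X hX i] (selState U D i) := by
    refine measurable_selState hU.adapted fun i _ => ?_
    have : {ω | D i (selState U D i ω) ω} =
        ⋃ k ∈ Set.Icc 1 n, {ω | τ k ω = ((i + 1 : ℕ) : ℕ∞)} := by
      ext ω; simp [D]
    rw [this]
    exact MeasurableSet.biUnion (Set.to_countable _) fun k hk =>
      (hτ.isStoppingTime k hk).measurableSet_eq (i + 1)
  have hae : ∀ᵐ ω ∂μ, (∀ i, D i (selState U D i ω) ω →
      (selState U D i ω).1 < n ∧ (selState U D i ω).2 ≤ U (i + 1) ω) ∧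
      ∀ i, (selState U D i ω).1 < n → (i : ℕ∞) < τ n ω := by
    filter_upwards [hτ.finite, hτ.one_le, hτ.time_lt, hτ.value_lt] with ω hfin h1 hlt hval
    have hcoe : ∀ k ∈ Set.Icc 1 n, τ k ω = ((τ k ω).toNat : ℕ∞) := fun k hk =>
      (ENat.natCast_toNat (hfin k hk)).symm
    have key := selState_of_selection_times (U := U) (D := D) (n := n) (ω := ω)
      (t := fun k => (τ k ω).toNat)
      (fun i s => exists_congr fun k => and_congr_right fun hk => by
        rw [hcoe k hk, ENat.toNat_natCast, Nat.cast_inj])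
      (fun k hk => by
        have := h1 k hk
        rw [hcoe k hk] at this
        exact_mod_cast this)
      (fun k hk hkn => by
        have := hlt k hk hkn
        rw [hcoe k ⟨hk, hkn.le⟩, hcoe (k + 1) ⟨by omega, hkn⟩] at this
        exact_mod_cast this)
    refine ⟨fun i hd => ?_, fun i hi => ?_⟩
    · obtain ⟨-, -, hL, hd'⟩ := key i
      obtain ⟨hKn, heq⟩ := hd' hd
      refine ⟨hKn, ?_⟩
      by_cases hK : 1 ≤ (selState U D i ω).1
      · rw [hL hK, ← heq]
        -- The distribution function need not be strictly increasing, so only a weak inequality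
        -- survives; this is why `horizonValue` admits `l ≤ x`.
        exact monotone_cdf F (hval _ hK hKn).le
      -- Before the first selection the state is still `(0, 0)`, whose second entry imposes no
      -- constraint on a value in `[0, 1]`.
      · have h0 : (selState U D i ω).2 = 0 := by
          clear hL hd' heq hKn hd
          have : ∀ j ≤ i, selState U D j ω = (0, 0) := by
            intro j hj
            induction j with
            | zero => rfl
            | succ j ih =>
              have hz : (selState U D (j + 1) ω).1 = 0 := by
                have := monotone_selState_fst (U := U) (D := D) (ω := ω) hj
                dsimp only at this
                omega
              rw [← ih (by omega)]
              refine selState_succ_of_neg fun hd => ?_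
              rw [selState_succ_of_pos hd] at hz
              omega
          rw [this i le_rfl]
        rw [h0]
        exact (hU.mem_Icc i ω).1
    · obtain ⟨-, hiff, -, -⟩ := key i
      have h2 := (hiff n ⟨hn, le_rfl⟩).not.2 (by omega)
      rw [hcoe n ⟨hn, le_rfl⟩]
      exact_mod_cast not_le.1 h2
  have hfin : ∀ N, horizonValue N n 0 ≤ ∫⁻ ω, (τ n ω : ENNReal) ∂μ := by
    intro N
    have h := horizonValue_le_sum hU hS (hae.mono fun ω h => h.1) N 0
    have h0 : ∀ ω, selState U D 0 ω = (0, 0) := fun _ => rfl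
    simp only [h0, Nat.sub_zero, lintegral_const, measure_univ, mul_one, zero_add] at h
    refine h.trans ?_
    rw [← lintegral_finsetSum]
    · refine lintegral_mono_ae (hae.mono fun ω h => ?_)
      rw [enat_toENNReal_eq_tsum]
      refine le_trans (Finset.sum_le_sum fun j _ => ?_) (ENNReal.sum_le_tsum (Finset.range N))
      split_ifs with h1 h2 h2
      · exact le_rfl
      · exact absurd (h.2 j h1) h2
      · exact zero_le
      · exact le_rfl
    · intro j _
      refine Measurable.ite ?_ measurable_const measurable_const
      exact measurableSet_lt (measurable_fst.comp ((hS j).mono ((obsFiltration X hX).le j) le_rfl))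
        measurable_const
  calc ENNReal.ofReal (optValue n) = valueFn n 0 := by simp [valueFn]
    _ ≤ ⨆ N, horizonValue N n 0 := valueFn_le_iSup_horizonValue n le_rfl zero_lt_one
    _ ≤ _ := iSup_le hfin

/-! ### The optimal policy -/

/-- The time at which the `k`-th value is selected, if the numbers of the values selected up to the
times `0, 1, …` are given by `K`. -/
noncomputable def selTime (K : ℕ → ℕ) (k : ℕ) : ℕ∞ :=
  open Classical in if h : ∃ i, k ≤ K i then (Nat.find h : ℕ∞) else ⊤

theorem selTime_le_iff {K : ℕ → ℕ} (hK : Monotone K) {k i : ℕ} :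
    selTime K k ≤ i ↔ k ≤ K i := by
  classical
  unfold selTime
  split_ifs with h
  · rw [Nat.cast_le]
    exact ⟨fun hi => (Nat.find_spec h).trans (hK hi), fun hi => Nat.find_min' h hi⟩
  · simp only [top_le_iff, ENat.natCast_ne_top, false_iff]
    exact fun hi => h ⟨i, hi⟩

theorem lt_selTime_iff {K : ℕ → ℕ} (hK : Monotone K) {k i : ℕ} :
    (i : ℕ∞) < selTime K k ↔ K i < k := by
  rw [← not_le, selTime_le_iff hK, not_le]

section optRule

variable {U : ℕ → Ω → ℝ} {n : ℕ} {ω : Ω}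

/-- The count rises by at most one per step, so it first reaches `k` through an actual selection at
time `a`. -/
theorem selState_of_selTime_eq {k a : ℕ} (hk : 1 ≤ k)
    (ha : selTime (fun i => (selState U (OptRule U n) i ω).1) k = a) :
    ∃ b, a = b + 1 ∧ selState U (OptRule U n) a ω = (k, U a ω) ∧
      (selState U (OptRule U n) b ω).2 < U a ω ∧ (selState U (OptRule U n) b ω).1 + 1 = k := by
  have hK := monotone_selState_fst (U := U) (D := OptRule U n) (ω := ω)
  have h1 : k ≤ (selState U (OptRule U n) a ω).1 := (selTime_le_iff hK).1 ha.le
  obtain _ | b := a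
  · simp only [selState] at h1
    omega
  have h2 : (selState U (OptRule U n) b ω).1 < k := by
    refine (lt_selTime_iff hK).1 ?_
    rw [ha]
    exact_mod_cast b.lt_succ_self
  have h3 := selState_fst_succ_le (U := U) (D := OptRule U n) (i := b) (ω := ω)
  have hd : OptRule U n b (selState U (OptRule U n) b ω) ω := by
    by_contra hd
    rw [selState_succ_of_neg hd] at h1
    omega
  refine ⟨b, rfl, ?_, hd.2.1, by omega⟩
  rw [selState_succ_of_pos hd]
  exact Prod.ext (by simp only; omega) rfl

theorem selState_eq_of_fst_eq {D : ℕ → ℕ × ℝ → Ω → Prop} {a b : ℕ} (hab : a ≤ b)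
    (h : (selState U D a ω).1 = (selState U D b ω).1) :
    selState U D a ω = selState U D b ω := by
  induction b, hab using Nat.le_induction with
  | base => rfl
  | succ b hb ih =>
    have hK := monotone_selState_fst (U := U) (D := D) (ω := ω)
    have h1 : (selState U D a ω).1 ≤ (selState U D b ω).1 := hK hb
    have h2 : (selState U D b ω).1 ≤ (selState U D (b + 1) ω).1 := hK b.le_succ
    have hd : ¬ D b (selState U D b ω) ω := fun hd => by
      rw [selState_succ_of_pos hd] at h h2
      simp only at h
      omega
    rw [selState_succ_of_neg hd]
    exact ih (by omega)

theorem selTime_lt_succ_and_lt {k : ℕ} (hk : 1 ≤ k)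
    (hfin : selTime (fun i => (selState U (OptRule U n) i ω).1) (k + 1) ≠ ⊤) :
    selTime (fun i => (selState U (OptRule U n) i ω).1) k <
        selTime (fun i => (selState U (OptRule U n) i ω).1) (k + 1) ∧
      U (selTime (fun i => (selState U (OptRule U n) i ω).1) k).toNat ω <
        U (selTime (fun i => (selState U (OptRule U n) i ω).1) (k + 1)).toNat ω := by
  have hK := monotone_selState_fst (U := U) (D := OptRule U n) (ω := ω)
  obtain ⟨c, hc⟩ := ENat.ne_top_iff_exists.1 hfin
  obtain ⟨b, rfl, -, hlt, hb⟩ := selState_of_selTime_eq (Nat.le_add_left 1 k) hc.symm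
  have hle : selTime (fun i => (selState U (OptRule U n) i ω).1) k ≤ b :=
    (selTime_le_iff hK).2 (by omega)
  obtain ⟨a, ha⟩ := ENat.ne_top_iff_exists.1 (ne_top_of_le_ne_top (ENat.natCast_ne_top b) hle)
  obtain ⟨-, -, hs, -, -⟩ := selState_of_selTime_eq hk ha.symm
  rw [← hc, ← ha]
  rw [← ha] at hle
  have hab : a ≤ b := by exact_mod_cast hle
  refine ⟨by exact_mod_cast Nat.lt_succ_of_le hab, ?_⟩
  -- Between two consecutive selections the state is frozen, so the value to be exceeded is the one
  -- selected at time `a`.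
  have := selState_eq_of_fst_eq (U := U) (D := OptRule U n) (ω := ω) hab (by rw [hs]; omega)
  rw [← this, hs] at hlt
  exact hlt

end optRule

theorem exists_isSelectionPolicy {μ : Measure Ω} [IsProbabilityMeasure μ] {X : ℕ → Ω → ℝ}
    (hX : ∀ i, 1 ≤ i → Measurable (X i)) (hindep : iIndepFun (fun i : ℕ => X (i + 1)) μ)
    {F : Measure ℝ} [IsProbabilityMeasure F] (hF : ∀ x, F {x} = 0)
    (hlaw : ∀ i, 1 ≤ i → μ.map (X i) = F) (n : ℕ) :
    ∃ τ, IsSelectionPolicy X hX μ n τ ∧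
      ∫⁻ ω, (τ n ω : ENNReal) ∂μ ≤ ENNReal.ofReal (optValue n) := by
  have hU := isUniformStream_cdf hX hindep hF hlaw
  set U : ℕ → Ω → ℝ := fun i ω => cdf F (X i ω) with hUdef
  have hS := measurable_selState_optRule hU.adapted n
  have hK : ∀ ω, Monotone fun i => (selState U (OptRule U n) i ω).1 :=
    fun ω => monotone_selState_fst
  let τ : ℕ → Ω → ℕ∞ := fun k ω => selTime (fun i => (selState U (OptRule U n) i ω).1) k
  have hst : ∀ k, IsStoppingTime (obsFiltration X hX) (τ k) := by
    intro k i
    have : {ω | τ k ω ≤ (i : ℕ∞)} = {ω | k ≤ (selState U (OptRule U n) i ω).1} :=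
      Set.ext fun ω => selTime_le_iff (hK ω)
    change MeasurableSet[obsFiltration X hX i] {ω | τ k ω ≤ (i : ℕ∞)}
    rw [this]
    exact measurableSet_le measurable_const (measurable_fst.comp (hS i))
  have hsum : ∀ ω, (τ n ω : ENNReal) =
      ∑' j, if (selState U (OptRule U n) j ω).1 < n then 1 else 0 := by
    intro ω
    rw [enat_toENNReal_eq_tsum]
    exact tsum_congr fun j => if_congr (lt_selTime_iff (hK ω)) rfl rfl
  have hmeas : ∀ j, Measurable fun ω =>
      if (selState U (OptRule U n) j ω).1 < n then (1 : ENNReal) else 0 := by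
    intro j
    refine Measurable.ite ?_ measurable_const measurable_const
    exact measurableSet_lt (measurable_fst.comp ((hS j).mono ((obsFiltration X hX).le j) le_rfl))
      measurable_const
  have hle : ∫⁻ ω, (τ n ω : ENNReal) ∂μ ≤ ENNReal.ofReal (optValue n) := by
    simp_rw [hsum]
    rw [lintegral_tsum fun j => (hmeas j).aemeasurable, ENNReal.tsum_eq_iSup_nat]
    refine iSup_le fun N => (le_self_add.trans (sum_add_lintegral_valueFn_le hU n N)).trans_eq ?_
    simp [valueFn]
  have hlt : ∫⁻ ω, (τ n ω : ENNReal) ∂μ < ⊤ := hle.trans_lt ENNReal.ofReal_lt_top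
  -- Finiteness of the last time comes from its finite expectation; the earlier times lie below it.
  have hfin : ∀ᵐ ω ∂μ, ∀ k ∈ Set.Icc 1 n, τ k ω ≠ ⊤ := by
    have hm : Measurable fun ω => (τ n ω : ENNReal) := by
      simp_rw [hsum]
      exact Measurable.tsum hmeas
    filter_upwards [ae_lt_top hm hlt.ne] with ω hω k hk
    have h1 : τ n ω ≠ ⊤ := fun h => by simp [h] at hω
    obtain ⟨a, ha⟩ := ENat.ne_top_iff_exists.1 h1
    have h2 := (selTime_le_iff (hK ω)).1 ha.ge
    exact ne_top_of_le_ne_top (ENat.natCast_ne_top a) ((selTime_le_iff (hK ω)).2 (hk.2.trans h2))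
  refine ⟨τ, ⟨fun k _ => hst k, hfin, ?_, ?_, ?_, hlt⟩, hle⟩
  · refine ae_of_all _ fun ω k hk => ?_
    rw [← not_lt, Order.lt_one_iff]
    intro h
    have h2 := (selTime_le_iff (hK ω) (k := k) (i := 0)).1 h.le
    have := hk.1
    simp only [selState] at h2
    omega
  · filter_upwards [hfin] with ω hω k hk hkn
    exact (selTime_lt_succ_and_lt hk (hω (k + 1) ⟨by omega, hkn⟩)).1
  · filter_upwards [hfin] with ω hω k hk hkn
    -- A monotone map reflects strict inequalities; hence the strict comparison in `OptRule`.
    exact (monotone_cdf F).reflect_lt (selTime_lt_succ_and_lt hk (hω (k + 1) ⟨by omega, hkn⟩)).2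

theorem isLeast_expectedTimes {μ : Measure Ω} [IsProbabilityMeasure μ] {X : ℕ → Ω → ℝ}
    (hX : ∀ i, 1 ≤ i → Measurable (X i)) (hindep : iIndepFun (fun i : ℕ => X (i + 1)) μ)
    {F : Measure ℝ} (hF : ∀ x, F {x} = 0)
    (hlaw : ∀ i, 1 ≤ i → μ.map (X i) = F) {n : ℕ} (hn : 1 ≤ n) :
    IsLeast (expectedTimes X hX μ n) (optValue n) := by
  have : IsProbabilityMeasure F :=
    hlaw 1 le_rfl ▸ Measure.isProbabilityMeasure_map (hX 1 le_rfl).aemeasurable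
  constructor
  · obtain ⟨τ, hτ, hle⟩ := exists_isSelectionPolicy hX hindep hF hlaw n
    refine ⟨τ, hτ, ?_⟩
    rw [le_antisymm hle (optValue_le_of_isSelectionPolicy hindep hF hlaw hn hτ),
      ENNReal.toReal_ofReal (optValue_nonneg n)]
  · rintro e ⟨τ, hτ, rfl⟩
    exact (ENNReal.ofReal_le_iff_le_toReal hτ.expectation_lt_top.ne).1
      (optValue_le_of_isSelectionPolicy hindep hF hlaw hn hτ)

end OnlineSelection

theorem theorem1 {Ω : Type*} {m : MeasurableSpace Ω} (μ : Measure Ω) [IsProbabilityMeasure μ]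
    (X : ℕ → Ω → ℝ) (hX : ∀ i, 1 ≤ i → Measurable (X i))
    (hindep : iIndepFun (fun i : ℕ => X (i + 1)) μ)
    (F : Measure ℝ) (hF : ∀ x, F {x} = 0) (hlaw : ∀ i, 1 ≤ i → μ.map (X i) = F) :
    (∀ n : ℕ, 1 ≤ n →
      IsLeast (OnlineSelection.expectedTimes X hX μ n) (OnlineSelection.beta X hX μ n)) ∧
    (∀ n : ℕ, 1 ≤ n →
      OnlineSelection.beta X hX μ (n + 1) - OnlineSelection.beta X hX μ n ≤
        OnlineSelection.beta X hX μ (n + 2) - OnlineSelection.beta X hX μ (n + 1)) ∧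
    OnlineSelection.beta X hX μ 1 = 1 ∧
    (∀ n : ℕ, 2 ≤ n →
      (n : ℝ) ^ 2 / 2 ≤ OnlineSelection.beta X hX μ n ∧
        OnlineSelection.beta X hX μ n ≤ (n : ℝ) ^ 2 / 2 + n * Real.log n) := by
  have hbeta : ∀ n : ℕ, 1 ≤ n →
      OnlineSelection.beta X hX μ n = OnlineSelection.optValue n := fun n hn =>
    (OnlineSelection.isLeast_expectedTimes hX hindep hF hlaw hn).csInf_eq
  refine ⟨fun n hn => ?_, fun n hn => ?_, ?_, fun n hn => ?_⟩
  · rw [hbeta n hn]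
    exact OnlineSelection.isLeast_expectedTimes hX hindep hF hlaw hn
  · rw [hbeta n hn, hbeta (n + 1) (by omega), hbeta (n + 2) (by omega)]
    exact OnlineSelection.optValue_sub_le_sub hn
  · rw [hbeta 1 le_rfl, OnlineSelection.optValue_one]
  · rw [hbeta n (by omega)]
    exact ⟨OnlineSelection.sq_div_two_le_optValue n, OnlineSelection.optValue_le hn⟩
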